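/- Two devices share a channel in discrete slots $t=0,1,2,\dots$. In each slot each device transmits or idles; a device that idles receives the response $0$, a device that transmits receives $1$ (success) if the other device idles, and $2_+$ (collision) if the other device transmits too. A policy is a function $f:\{0,1,2_+\}^*\to[0,1]$ with $f(w)=0$ whenever $1$ occurs in $w$. Both devices run the same policy with independent private randomness: in slot $t$, a device whose previous responses form the word $w$ transmits with probability $f(w)$, i.e. iff $U_{k,t}<f(w)$, where $(U_{k,t})$ ($k=1,2$, $t\ge 0$) are i.i.d. uniform on $[0,1]$. Let $X_k\in\{1,2,\dots\}\cup\{\infty\}$ be one plus the index of the slot in which device $k$ succeeds ($\infty$ if there is none). A policy is optimal under the MAX objective if it minimizes $\mathbb{E}\max(X_1,X_2)\in[0,\infty]$ among all policies. The polynomial $x^3+7x^2-21x+9$ has a unique root $\alpha\approx 0.528837$ in $[0,1]$, the polynomial $4x^3-8x^2+3$ has a unique root $\beta\approx 0.785997$ in $[0,1]$, and the polynomial $3x^3-12x^2+10x-2$ has a unique root $\gamma\approx 0.299723$ in $[1/4,1/3]$. Consider the following protocol (MAX-Contention Resolution), started in Step 1. Step 1. Transmit with probability $\alpha$. If successful,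 halt; if there was a collision, repeat Step 1; otherwise proceed to Step 2. Step 2. Transmit with probability $\beta$. If successful, halt; if there was a collision, go to Step 1; otherwise proceed to Step 3. Step 3. Transmit with probability $1$. If successful, halt; otherwise go to Step 1. This protocol is an optimal policy for two devices under the MAX objective, and its expected maximum latency is $\mathbb{E}\max(X_1,X_2)=1/\gamma\approx 3.33641$. (Here $\approx$ means correct rounding to the displayed digits.) -/

import Mathlib

open MeasureTheory
open scoped ENNReal

namespace ContentionResolution

/-- Channel feedback: `idle` is the response `0`, `success` is `1`, `collision` is `2₊`. -/
inductive Response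
  | idle
  | success
  | collision

/-- A proper policy: the probability of transmitting as a function of the device's own history
(the word of its past responses, in chronological order). Once a device has succeeded it must
remain idle. -/
structure Policy where
  prob : List Response → unitInterval
  halts : ∀ w, Response.success ∈ w → prob w = 0

/-- Outcomes of a random board with `n` rows: one number in `[0,1]` for each device and slot. -/
abbrev Board (n : ℕ) : Type := Fin n × ℕ → unitInterval

/-- The law of the random board: the entries are i.i.d. uniform on `[0,1]`. -/
noncomputable def boardMeasure (n : ℕ) : Measure (Board n) :=
  Measure.infinitePi fun _ : Fin n × ℕ => (volume : Measure unitInterval)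

open Classical in
/-- The response received by device `k` when `d j` says whether device `j` transmits. -/
noncomputable def respond {n : ℕ} (d : Fin n → Prop) (k : Fin n) : Response :=
  if ¬ d k then Response.idle
  else if ∀ j, j ≠ k → ¬ d j then Response.success
  else Response.collision

/-- `history f u t k` is the history of device `k` before slot `t`, when all devices run the policy
`f`: device `k` transmits in slot `t` iff `u (k, t) < f (history of k before slot t)`. -/
noncomputable def history {n : ℕ} (f : Policy) (u : Board n) : ℕ → Fin n → List Response
  | 0, _ => []
  | t + 1, k =>
      history f u t k ++ [respond (fun j => u (j, t) < f.prob (history f u t j)) k]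

/-- Device `k` transmits in slot `t`. -/
def Transmits {n : ℕ} (f : Policy) (u : Board n) (k : Fin n) (t : ℕ) : Prop :=
  u (k, t) < f.prob (history f u t k)

/-- The response that device `k` receives at the end of slot `t`. -/
noncomputable def response {n : ℕ} (f : Policy) (u : Board n) (k : Fin n) (t : ℕ) : Response :=
  respond (fun j => Transmits f u j t) k

/-- The latency `1 + min {t | device k succeeds in slot t}`, which is `⊤` if there is no such `t`. -/
noncomputable def latency {n : ℕ} (f : Policy) (u : Board n) (k : Fin n) : ℕ∞ :=
  ⨅ (t : ℕ) (_ : response f u k t = Response.success), ((t + 1 : ℕ) : ℕ∞)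

/-- The expected cost of the policy `f`, run by `n` devices, for the cost function `T` of the
vector of latencies. -/
noncomputable def expectedCost {n : ℕ} (T : (Fin n → ℕ∞) → ℝ≥0∞) (f : Policy) : ℝ≥0∞ :=
  ∫⁻ u, T (fun k => latency f u k) ∂(boardMeasure n)

/-- The policy `f` is optimal for `n` devices and the cost function `T`. -/
def IsOptimal {n : ℕ} (T : (Fin n → ℕ∞) → ℝ≥0∞) (f : Policy) : Prop :=
  ∀ g : Policy, expectedCost T f ≤ expectedCost T g

/-- The max objective for two devices. -/
noncomputable def maxObjective (x : Fin 2 → ℕ∞) : ℝ≥0∞ :=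
  ((max (x 0) (x 1) : ℕ∞) : ℝ≥0∞)

/-- The control states of the three-step protocol. -/
inductive Step
  | step1
  | step2
  | step3
  | halted

/-- The transition of the protocol after a response of the channel: halt after a success; after a
collision go to Step 1; after idling go from Step 1 to Step 2, from Step 2 to Step 3, and from
Step 3 to Step 1. -/
def Step.next : Step → Response → Step
  | .halted, _ => .halted
  | _, .success => .halted
  | _, .collision => .step1
  | .step1, .idle => .step2
  | .step2, .idle => .step3
  | .step3, .idle => .step1

/-- The transmission probability in each state, for the parameters `α`, `β`. -/
def Step.transmitProb (α β : unitInterval) : Step → unitInterval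
  | .step1 => α
  | .step2 => β
  | .step3 => 1
  | .halted => 0

/-- The state reached from state `s` after the responses `w`. -/
def Step.run (s : Step) (w : List Response) : Step := w.foldl Step.next s

theorem Step.run_halted (w : List Response) : Step.run .halted w = .halted := by
  induction w with
  | nil => rfl
  | cons r w ih => exact ih

theorem Step.run_of_success_mem (w : List Response) (s : Step) (h : Response.success ∈ w) :
    Step.run s w = .halted := by
  induction w generalizing s with
  | nil => simp at h
  | cons r w ih =>
    rcases List.mem_cons.mp h with h | h
    · subst h
      have : Step.next s .success = .halted := by cases s <;> rfl
      change Step.run (Step.next s .success) w = _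
      rw [this, Step.run_halted]
    · exact ih (Step.next s r) h

/-- The three-step protocol with transmission probabilities `α`, `β`, `1`, started in Step 1. -/
def threeStepProtocol (α β : unitInterval) : Policy where
  prob w := Step.transmitProb α β (Step.run .step1 w)
  halts w h := by rw [Step.run_of_success_mem w .step1 h]; rfl

end ContentionResolution

/-!
After a collision both devices have the same history, so the process renews and splits into rounds.
As long as no device has transmitted in a round, the devices idle on a common history; they
therefore draw the slots of their first transmission independently from one law, with tails
`1 = b 0 ≥ b 1 ≥ b 2 ≥ ⋯`. A device that is left alone has only idled in the round, so it keeps to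
its draw. Hence the round has expected length `T = ∑ (2 b k - b k ^ 2)` and ends in a collision with
probability `C = ∑ (b k - b (k + 1)) ^ 2`.

Repeating one round forever costs `J = T + C J`, so cost `1 / γ` cannot be beaten as soon as
`γ T + C ≥ 1` for all tails. The first four slots already give this: the terms with `b 1`, `b 2`,
`b 3` form a quadratic polynomial whose minimum over `b 3 ∈ [0, 1]` is `1` when `γ` is the root of
the cubic. The minimizer has `b 3 = 0` and is the tail sequence of the three-step protocol.
-/

namespace ContentionResolution

open ProbabilityTheory unitInterval

section Chain

variable {n : ℕ}

instance : Finite Response :=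
  Finite.of_surjective ![Response.idle, .success, .collision] fun
    | .idle => ⟨0, rfl⟩
    | .success => ⟨1, rfl⟩
    | .collision => ⟨2, rfl⟩

instance : MeasurableSpace (List Response) := ⊤

instance : DiscreteMeasurableSpace (List Response) := ⟨fun _ => trivial⟩

instance : IsProbabilityMeasure (boardMeasure n) := by
  unfold boardMeasure; infer_instance

/-- The histories `h` of all devices prolonged by one slot, in which device `k` draws the
number `v k`. -/
noncomputable def advance (f : Policy) (h : Fin n → List Response) (v : Fin n → I) :
    Fin n → List Response :=
  fun k => h k ++ [respond (fun j => v j < f.prob (h j)) k]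

theorem history_succ (f : Policy) (u : Board n) (t : ℕ) :
    history f u (t + 1) = advance f (history f u t) fun k => u (k, t) :=
  rfl

theorem measurable_advance (f : Policy) :
    Measurable fun p : (Fin n → List Response) × (Fin n → I) => advance f p.1 p.2 := by
  refine measurable_from_prod_countable_right fun h => ?_
  have hdecide : Measurable fun (v : Fin n → I) (j : Fin n) => v j < f.prob (h j) :=
    measurable_pi_iff.2 fun j =>
      measurableSet_setOfPred.1 (measurableSet_lt (measurable_pi_apply j) measurable_const)
  exact (Measurable.of_discrete (f := fun (d : Fin n → Prop) k => h k ++ [respond d k])).comp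
    hdecide

/- The sample space is arbitrary so that the lemma applies to the σ-algebra generated by the part
of the board that precedes slot `t`. -/
theorem measurable_history {Ω : Type*} [MeasurableSpace Ω] (f : Policy) {u : Ω → Board n} {t : ℕ}
    (hu : ∀ k, ∀ s < t, Measurable fun ω => u ω (k, s)) :
    Measurable fun ω => history f (u ω) t := by
  induction t with
  | zero => exact measurable_const (a := fun _ : Fin n => ([] : List Response))
  | succ t ih =>
    simp only [history_succ]
    exact (measurable_advance f).comp
      ((ih fun k s hs => hu k s (hs.trans t.lt_succ_self)).prodMk
        (measurable_pi_iff.2 fun k => hu k t t.lt_succ_self))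

theorem measurable_history_board (f : Policy) (t : ℕ) :
    Measurable fun u : Board n => history f u t :=
  measurable_history f fun k s _ => measurable_pi_apply (k, s)

theorem iIndepFun_board :
    iIndepFun (fun (i : Fin n × ℕ) (u : Board n) => u i) (boardMeasure n) :=
  iIndepFun_infinitePi (X := fun _ x => x) fun _ => measurable_id

theorem indepFun_history_slot (f : Policy) (t : ℕ) :
    IndepFun (fun u : Board n => history f u t) (fun u k => u (k, t)) (boardMeasure n) := by
  let generated (S : Set (Fin n × ℕ)) : MeasurableSpace (Board n) :=
    ⨆ i ∈ S, MeasurableSpace.comap (fun u => u i) inferInstance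
  have measurable_eval {S : Set (Fin n × ℕ)} {i} (hi : i ∈ S) :
      Measurable[generated S] fun u : Board n => u i :=
    (comap_measurable _).mono (le_iSup₂_of_le i hi le_rfl) le_rfl
  have hindep : Indep (generated {i | i.2 < t}) (generated {i | i.2 = t}) (boardMeasure n) :=
    indep_iSup_of_disjoint (fun i => (measurable_pi_apply i).comap_le) iIndepFun_board
      (Set.disjoint_left.2 fun _ hlt heq => hlt.ne heq)
  refine (IndepFun_iff_Indep _ _ _).2 (indep_of_indep_of_le_right
    (indep_of_indep_of_le_left hindep (Measurable.comap_le ?_)) (Measurable.comap_le ?_))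
  · exact @measurable_history n _ (generated _) f id t fun _ _ hs => measurable_eval hs
  · exact @measurable_pi_lambda _ _ _ (generated _) _ _ fun _ => measurable_eval rfl

theorem map_slot_boardMeasure (t : ℕ) :
    (boardMeasure n).map (fun u k => u (k, t)) = (volume : Measure (Fin n → I)) := by
  have hslot : iIndepFun (fun (k : Fin n) (u : Board n) => u (k, t)) (boardMeasure n) :=
    iIndepFun_board.precomp (Prod.mk_left_injective t)
  rw [(iIndepFun_iff_map_fun_eq_pi_map fun k => (measurable_pi_apply (k, t)).aemeasurable).1 hslot,
    volume_pi]
  congr 1 with k : 1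
  exact Measure.infinitePi_map_eval _ (k, t)

/-- The transition operator of the Markov chain of histories: the expectation of `φ` after one more
slot. -/
noncomputable def transition (f : Policy) (φ : (Fin n → List Response) → ℝ≥0∞)
    (h : Fin n → List Response) : ℝ≥0∞ :=
  ∫⁻ v, φ (advance f h v)

theorem measurable_comp_advance (f : Policy) (φ : (Fin n → List Response) → ℝ≥0∞)
    (h : Fin n → List Response) : Measurable fun v => φ (advance f h v) :=
  (Measurable.of_discrete (f := φ)).comp ((measurable_advance f).comp measurable_prodMk_left)

theorem lintegral_history_succ (f : Policy) (φ : (Fin n → List Response) → ℝ≥0∞) (t : ℕ) :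
    ∫⁻ u, φ (history f u (t + 1)) ∂boardMeasure n =
      ∫⁻ u, transition f φ (history f u t) ∂boardMeasure n := by
  have hhist := measurable_history_board (n := n) f t
  have hslot : Measurable fun (u : Board n) k => u (k, t) := by fun_prop
  have hφ : Measurable fun p : (Fin n → List Response) × (Fin n → I) => φ (advance f p.1 p.2) :=
    (Measurable.of_discrete (f := φ)).comp (measurable_advance f)
  have hlaw := (indepFun_history_slot f t).map_prod_eq_prod_map_map hhist.aemeasurable
    hslot.aemeasurable
  rw [map_slot_boardMeasure] at hlaw
  calc ∫⁻ u, φ (history f u (t + 1)) ∂boardMeasure n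
      = ∫⁻ p, φ (advance f p.1 p.2)
          ∂(boardMeasure n).map fun u => (history f u t, fun k => u (k, t)) :=
        (lintegral_map hφ (hhist.prodMk hslot)).symm
    _ = ∫⁻ h, transition f φ h ∂(boardMeasure n).map fun u => history f u t := by
        rw [hlaw, lintegral_prod _ hφ.aemeasurable]
        rfl
    _ = ∫⁻ u, transition f φ (history f u t) ∂boardMeasure n :=
        lintegral_map .of_discrete hhist

theorem lintegral_history (f : Policy) (φ : (Fin n → List Response) → ℝ≥0∞) (t : ℕ) :
    ∫⁻ u, φ (history f u t) ∂boardMeasure n = (transition f)^[t] φ fun _ => [] := by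
  induction t generalizing φ with
  | zero =>
    simp only [history, lintegral_const, measure_univ, mul_one, Function.iterate_zero, id_eq]
  | succ t ih => rw [lintegral_history_succ, ih, Function.iterate_succ_apply]

theorem transition_mono (f : Policy) {φ ψ : (Fin n → List Response) → ℝ≥0∞} (hφψ : φ ≤ ψ) :
    transition f φ ≤ transition f ψ :=
  fun h => lintegral_mono fun v => hφψ (advance f h v)

theorem transition_tsum (f : Policy) (φ : ℕ → (Fin n → List Response) → ℝ≥0∞)
    (h : Fin n → List Response) :
    transition f (fun h => ∑' t, φ t h) h = ∑' t, transition f (φ t) h :=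
  lintegral_tsum fun t => (measurable_comp_advance f (φ t) h).aemeasurable

theorem transition_sum (f : Policy) (φ : ℕ → (Fin n → List Response) → ℝ≥0∞) (s : Finset ℕ)
    (h : Fin n → List Response) :
    transition f (fun h => ∑ t ∈ s, φ t h) h = ∑ t ∈ s, transition f (φ t) h :=
  lintegral_finsetSum s fun t _ => measurable_comp_advance f (φ t) h

theorem respond_comp_perm (d : Fin n → Prop) (e : Equiv.Perm (Fin n)) (k : Fin n) :
    respond (d ∘ e) k = respond d (e k) := by
  have halone : (∀ j, j ≠ k → ¬ d (e j)) ↔ ∀ j, j ≠ e k → ¬ d j :=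
    e.forall_congr fun j => by rw [e.injective.ne_iff]
  unfold respond
  congr! 2

theorem advance_comp_perm (f : Policy) (h : Fin n → List Response) (v : Fin n → I)
    (e : Equiv.Perm (Fin n)) : advance f (h ∘ e) (v ∘ e) = advance f h v ∘ e := by
  funext k
  exact congrArg (fun r => h (e k) ++ [r])
    (respond_comp_perm (fun j => v j < f.prob (h j)) e k)

theorem transition_comp_perm (f : Policy) (φ : (Fin n → List Response) → ℝ≥0∞)
    (h : Fin n → List Response) (e : Equiv.Perm (Fin n)) :
    transition f φ (h ∘ e) = transition f (fun h => φ (h ∘ e)) h := by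
  have hperm := volume_preserving_arrowCongr' e.symm (MeasurableEquiv.refl I) (.id volume)
  unfold transition
  rw [← hperm.lintegral_comp_emb (MeasurableEquiv.measurableEmbedding _)]
  refine lintegral_congr fun v => ?_
  exact congrArg φ (advance_comp_perm f h _ e)

end Chain

section RemainingTime

variable {n : ℕ}

open Classical in
/-- The cost of a slot before which the histories are `h`: it counts as long as some device has
not succeeded. -/
noncomputable def slotCost (h : Fin n → List Response) : ℝ≥0∞ :=
  if ∀ k, .success ∈ h k then 0 else 1

theorem slotCost_le_one (h : Fin n → List Response) : slotCost h ≤ 1 := by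
  unfold slotCost
  split_ifs <;> simp only [zero_le, le_refl]

theorem slotCost_of_notMem {h : Fin n → List Response} {k : Fin n} (hk : .success ∉ h k) :
    slotCost h = 1 :=
  if_neg fun hall => hk (hall k)

theorem success_mem_history_iff (f : Policy) (u : Board n) (t : ℕ) (k : Fin n) :
    .success ∈ history f u t k ↔ ∃ s < t, response f u k s = .success := by
  induction t with
  | zero => simp only [history, List.not_mem_nil, not_lt_zero, false_and, exists_false]
  | succ t ih =>
    change .success ∈ history f u t k ++ [response f u k t] ↔ _
    rw [List.mem_append, ih, List.mem_singleton, Nat.exists_lt_succ_right,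
      eq_comm (a := Response.success)]

theorem lt_latency_iff (f : Policy) (u : Board n) (t : ℕ) (k : Fin n) :
    (t : ℕ∞) < latency f u k ↔ .success ∉ history f u t k := by
  rw [success_mem_history_iff, ← ENat.add_one_le_iff (ENat.natCast_ne_top t), latency]
  simp only [le_iInf_iff, not_exists, not_and]
  refine forall_congr' fun s => ?_
  rw [imp_not_comm, not_lt]
  norm_cast
  rw [Nat.add_le_add_iff_right]

theorem toENNReal_eq_tsum_ite (N : ℕ∞) :
    (N : ℝ≥0∞) = ∑' t : ℕ, if (t : ℕ∞) < N then 1 else 0 := by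
  induction N using ENat.recTopCoe with
  | top => simp
  | coe N =>
    rw [tsum_eq_sum (s := Finset.range N) (by simp), ← Finset.sum_filter]
    simp [Finset.filter_true_of_mem]

theorem iSup_latency_eq_tsum (f : Policy) (u : Board n) :
    ((⨆ k, latency f u k : ℕ∞) : ℝ≥0∞) = ∑' t, slotCost (history f u t) := by
  rw [toENNReal_eq_tsum_ite]
  refine tsum_congr fun t => ?_
  have hle : ¬ (t : ℕ∞) < ⨆ k, latency f u k ↔ ∀ k, .success ∈ history f u t k := by
    simp only [lt_iSup_iff, lt_latency_iff, not_exists, not_not]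
  rw [slotCost, ← ite_not]
  congr! 1

/-- The expected number of slots, from the histories `h` on, until all devices have succeeded. -/
noncomputable def remainingTime (f : Policy) (h : Fin n → List Response) : ℝ≥0∞ :=
  ∑' t, (transition f)^[t] slotCost h

theorem lintegral_iSup_latency (f : Policy) :
    ∫⁻ u, ((⨆ k, latency f u k : ℕ∞) : ℝ≥0∞) ∂boardMeasure n =
      remainingTime f fun _ : Fin n => [] := by
  simp only [iSup_latency_eq_tsum]
  rw [lintegral_tsum (f := fun t u => slotCost (history f u t)) fun t =>
    ((Measurable.of_discrete (f := slotCost)).comp (measurable_history_board f t)).aemeasurable]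
  exact tsum_congr fun t => lintegral_history f slotCost t

theorem remainingTime_eq (f : Policy) (h : Fin n → List Response) :
    remainingTime f h = slotCost h + transition f (remainingTime f) h := by
  have hshift : transition f (remainingTime f) h = ∑' t, (transition f)^[t + 1] slotCost h := by
    simp only [Function.iterate_succ_apply']
    exact transition_tsum f (fun t => (transition f)^[t] slotCost) h
  rw [hshift, remainingTime,
    tsum_eq_zero_add' (f := fun t => (transition f)^[t] slotCost h) ENNReal.summable]
  rfl

theorem remainingTime_le_of_superharmonic (f : Policy) {V : (Fin n → List Response) → ℝ≥0∞}
    (hV : ∀ h, slotCost h + transition f V h ≤ V h) : remainingTime f ≤ V := by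
  have hpartial (N : ℕ) :
      (fun h => ∑ t ∈ Finset.range N, (transition f)^[t] slotCost h) ≤ V := by
    induction N with
    | zero => exact fun h => zero_le
    | succ N ih =>
      intro h
      calc ∑ t ∈ Finset.range (N + 1), (transition f)^[t] slotCost h
          = slotCost h
            + transition f (fun h => ∑ t ∈ Finset.range N, (transition f)^[t] slotCost h) h := by
            rw [Finset.sum_range_succ', add_comm, transition_sum]
            simp only [Function.iterate_succ_apply', Function.iterate_zero, id_eq]
        _ ≤ slotCost h + transition f V h := by gcongr; exact transition_mono f ih h
        _ ≤ V h := hV h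
  exact fun h => ENNReal.tsum_le_of_sum_range_le fun N => hpartial N h

theorem remainingTime_comp_perm (f : Policy) (h : Fin n → List Response)
    (e : Equiv.Perm (Fin n)) : remainingTime f (h ∘ e) = remainingTime f h := by
  refine tsum_congr fun t => ?_
  induction t generalizing h with
  | zero =>
    have hall : (∀ k, .success ∈ (h ∘ e) k) ↔ ∀ k, .success ∈ h k :=
      e.forall_congr_right (q := fun k => .success ∈ h k)
    simp only [Function.iterate_zero, id_eq, slotCost]
    congr! 1
  | succ t ih => simp only [Function.iterate_succ_apply', transition_comp_perm, ih]

end RemainingTime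

section TwoDevices

theorem maxObjective_eq_iSup (x : Fin 2 → ℕ∞) : maxObjective x = ((⨆ k, x k : ℕ∞) : ℝ≥0∞) := by
  have hsup : max (x 0) (x 1) = ⨆ k, x k :=
    le_antisymm (max_le (le_iSup x 0) (le_iSup x 1))
      (iSup_le (Fin.forall_fin_two.2 ⟨le_max_left _ _, le_max_right _ _⟩))
  rw [maxObjective, hsup]

theorem expectedCost_maxObjective (f : Policy) :
    expectedCost maxObjective f = remainingTime f ![[], []] := by
  simp only [expectedCost, maxObjective_eq_iSup, lintegral_iSup_latency]
  congr 1 with k : 1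
  fin_cases k <;> rfl

theorem lintegral_ite_lt (p : I) (A B : ℝ≥0∞) :
    ∫⁻ v : I, (if v < p then A else B) =
      ENNReal.ofReal p * A + ENNReal.ofReal (1 - p) * B := by
  have hsplit := lintegral_add_compl (μ := volume) (fun v : I => if v < p then A else B)
    (measurableSet_Iio (a := p))
  have hlt : ∫⁻ v in Set.Iio p, (if v < p then A else B) = A * volume (Set.Iio p) := by
    rw [← setLIntegral_const]
    exact setLIntegral_congr_fun measurableSet_Iio fun v hv => if_pos hv
  have hge : ∫⁻ v in (Set.Iio p)ᶜ, (if v < p then A else B) = B * volume (Set.Iio p)ᶜ := by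
    rw [← setLIntegral_const]
    exact setLIntegral_congr_fun measurableSet_Iio.compl fun v hv => if_neg hv
  rw [← hsplit, hlt, hge, Set.compl_Iio, unitInterval.volume_Iio, unitInterval.volume_Ici,
    mul_comm A, mul_comm B]

theorem advance_pair (f : Policy) (x y : List Response) (v : Fin 2 → I) :
    advance f ![x, y] v =
      if v 0 < f.prob x then
        if v 1 < f.prob y then ![x ++ [.collision], y ++ [.collision]]
        else ![x ++ [.success], y ++ [.idle]]
      else
        if v 1 < f.prob y then ![x ++ [.idle], y ++ [.success]]
        else ![x ++ [.idle], y ++ [.idle]] := by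
  funext k
  fin_cases k <;> split_ifs with hx hy hy <;> simp [advance, respond, Fin.forall_fin_two, hx, hy]

theorem transition_pair (f : Policy) (φ : (Fin 2 → List Response) → ℝ≥0∞) (x y : List Response) :
    transition f φ ![x, y] =
      ENNReal.ofReal (f.prob x) *
          (ENNReal.ofReal (f.prob y) * φ ![x ++ [.collision], y ++ [.collision]]
            + ENNReal.ofReal (1 - f.prob y) * φ ![x ++ [.success], y ++ [.idle]])
        + ENNReal.ofReal (1 - f.prob x) *
          (ENNReal.ofReal (f.prob y) * φ ![x ++ [.idle], y ++ [.success]]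
            + ENNReal.ofReal (1 - f.prob y) * φ ![x ++ [.idle], y ++ [.idle]]) := by
  have hpair := (volume_preserving_finTwoArrow I).symm
  have hmeas : Measurable fun v : I × I => φ (advance f ![x, y] ![v.1, v.2]) :=
    (measurable_comp_advance f φ ![x, y]).comp hpair.measurable
  have hprod : transition f φ ![x, y] = ∫⁻ v : I × I, φ (advance f ![x, y] ![v.1, v.2]) :=
    (hpair.lintegral_comp (measurable_comp_advance f φ ![x, y])).symm
  rw [hprod, Measure.volume_eq_prod, lintegral_prod _ hmeas.aemeasurable, ← lintegral_ite_lt]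
  refine lintegral_congr fun v => ?_
  simp only [advance_pair, Matrix.cons_val_zero, Matrix.cons_val_one, Matrix.cons_val_fin_one]
  split_ifs <;> simp only [apply_ite φ, lintegral_ite_lt]

theorem remainingTime_pair_comm (f : Policy) (x y : List Response) :
    remainingTime f ![x, y] = remainingTime f ![y, x] := by
  rw [← remainingTime_comp_perm f ![y, x] (Equiv.swap 0 1)]
  congr 1 with k : 1
  fin_cases k <;> rfl

theorem remainingTime_diag (f : Policy) {w : List Response} (hw : .success ∉ w) :
    remainingTime f ![w, w] =
      1 + (ENNReal.ofReal (f.prob w) *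
            (ENNReal.ofReal (f.prob w) * remainingTime f ![w ++ [.collision], w ++ [.collision]]
              + ENNReal.ofReal (1 - f.prob w) * remainingTime f ![w ++ [.success], w ++ [.idle]])
        + ENNReal.ofReal (1 - f.prob w) *
            (ENNReal.ofReal (f.prob w) * remainingTime f ![w ++ [.success], w ++ [.idle]]
              + ENNReal.ofReal (1 - f.prob w) *
                remainingTime f ![w ++ [.idle], w ++ [.idle]])) := by
  rw [remainingTime_eq, slotCost_of_notMem (k := 0) hw, transition_pair,
    remainingTime_pair_comm f (w ++ [Response.idle]) (w ++ [Response.success])]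

theorem one_add_le_remainingTime (f : Policy) {x w : List Response} (hx : .success ∈ x)
    (hw : .success ∉ w) :
    1 + ENNReal.ofReal (1 - f.prob w) * remainingTime f ![x ++ [.idle], w ++ [.idle]]
      ≤ remainingTime f ![x, w] := by
  rw [remainingTime_eq f ![x, w], slotCost_of_notMem (k := 1) hw, transition_pair, f.halts x hx]
  simp only [Set.Icc.coe_zero, ENNReal.ofReal_zero, zero_mul, zero_add, sub_zero,
    ENNReal.ofReal_one, one_mul]
  gcongr
  exact le_add_self

theorem one_add_ofReal {x : ℝ} (hx : 0 ≤ x) : 1 + ENNReal.ofReal x = ENNReal.ofReal (1 + x) := by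
  rw [ENNReal.ofReal_add zero_le_one hx, ENNReal.ofReal_one]

theorem ofReal_two_device_step {p A B C : ℝ} (hp : p ∈ Set.Icc 0 1) (hA : 0 ≤ A) (hB : 0 ≤ B)
    (hC : 0 ≤ C) :
    1 + (ENNReal.ofReal p *
          (ENNReal.ofReal p * ENNReal.ofReal A + ENNReal.ofReal (1 - p) * ENNReal.ofReal B)
        + ENNReal.ofReal (1 - p) *
          (ENNReal.ofReal p * ENNReal.ofReal B + ENNReal.ofReal (1 - p) * ENNReal.ofReal C))
      = ENNReal.ofReal (1 + p ^ 2 * A + 2 * p * (1 - p) * B + (1 - p) ^ 2 * C) := by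
  have hp0 : 0 ≤ p := hp.1
  have hq0 : 0 ≤ 1 - p := sub_nonneg.2 hp.2
  rw [← ENNReal.ofReal_one]
  repeat first
    | rw [← ENNReal.ofReal_mul (by positivity)]
    | rw [← ENNReal.ofReal_add (by positivity) (by positivity)]
  congr 1
  ring

end TwoDevices

section LowerBound

/-- The time that two devices which draw the slot of their first transmission independently, with
tail function `b`, spend in the first `n` slots until both have transmitted. -/
noncomputable def roundTime (b : ℕ → ℝ) (n : ℕ) : ℝ :=
  ∑ k ∈ Finset.range n, (2 * b k - b k ^ 2)

/-- The probability that two devices which draw the slot of their first transmission independently,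
with tail function `b`, both draw the same one of the first `n` slots. -/
noncomputable def collisionProb (b : ℕ → ℝ) (n : ℕ) : ℝ :=
  ∑ k ∈ Finset.range n, (b k - b (k + 1)) ^ 2

/-- The probability that a device with the history `w` idles in the next `k` slots, when it runs
the policy `f`. -/
noncomputable def idleProb (f : Policy) : List Response → ℕ → ℝ
  | _, 0 => 1
  | w, k + 1 => (1 - f.prob w) * idleProb f (w ++ [.idle]) k

theorem idleProb_mem_Icc (f : Policy) (w : List Response) (k : ℕ) :
    idleProb f w k ∈ Set.Icc 0 1 := by
  induction k generalizing w with
  | zero => exact ⟨zero_le_one, le_rfl⟩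
  | succ k ih => exact unitInterval.mul_mem (Set.Icc.mem_iff_one_sub_mem.1 (f.prob w).2) (ih _)

theorem roundTime_nonneg {b : ℕ → ℝ} (hb : ∀ k, b k ∈ Set.Icc 0 1) (n : ℕ) :
    0 ≤ roundTime b n :=
  Finset.sum_nonneg fun k _ => by nlinarith [(hb k).1, (hb k).2]

theorem collisionProb_nonneg (b : ℕ → ℝ) (n : ℕ) : 0 ≤ collisionProb b n :=
  Finset.sum_nonneg fun _ _ => sq_nonneg _

theorem one_le_roundTime_succ {b : ℕ → ℝ} (hb : ∀ k, b k ∈ Set.Icc 0 1) (hb0 : b 0 = 1) (n : ℕ) :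
    1 ≤ roundTime b (n + 1) := by
  have htail := roundTime_nonneg (fun k => hb (k + 1)) n
  rw [roundTime, Finset.sum_range_succ', hb0]
  rw [roundTime] at htail
  linarith

theorem roundTime_idleProb_succ (f : Policy) (w : List Response) (n : ℕ) :
    roundTime (idleProb f w) (n + 1) =
      1 + 2 * f.prob w * (1 - f.prob w) * ∑ k ∈ Finset.range n, idleProb f (w ++ [.idle]) k
        + (1 - f.prob w) ^ 2 * roundTime (idleProb f (w ++ [.idle])) n := by
  simp only [roundTime, Finset.sum_range_succ', idleProb, Finset.mul_sum]
  rw [add_comm, add_assoc, ← Finset.sum_add_distrib]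
  congr 1
  · norm_num
  · exact Finset.sum_congr rfl fun k _ => by ring

theorem collisionProb_idleProb_succ (f : Policy) (w : List Response) (n : ℕ) :
    collisionProb (idleProb f w) (n + 1) =
      f.prob w ^ 2 + (1 - f.prob w) ^ 2 * collisionProb (idleProb f (w ++ [.idle])) n := by
  simp only [collisionProb, Finset.sum_range_succ', idleProb, Finset.mul_sum]
  rw [add_comm]
  congr 1
  · ring
  · exact Finset.sum_congr rfl fun k _ => by ring

theorem ofReal_sum_idleProb_le_remainingTime (f : Policy) {x w : List Response}
    (hx : .success ∈ x) (hw : .success ∉ w) (n : ℕ) :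
    ENNReal.ofReal (∑ k ∈ Finset.range n, idleProb f w k) ≤ remainingTime f ![x, w] := by
  induction n generalizing x w with
  | zero => simp only [Finset.range_zero, Finset.sum_empty, ENNReal.ofReal_zero, zero_le]
  | succ n ih =>
    have hq : 0 ≤ 1 - (f.prob w : ℝ) := sub_nonneg.2 (f.prob w).2.2
    have hsum : 0 ≤ ∑ k ∈ Finset.range n, idleProb f (w ++ [.idle]) k :=
      Finset.sum_nonneg fun k _ => (idleProb_mem_Icc f _ k).1
    calc ENNReal.ofReal (∑ k ∈ Finset.range (n + 1), idleProb f w k)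
        = 1 + ENNReal.ofReal (1 - f.prob w) *
            ENNReal.ofReal (∑ k ∈ Finset.range n, idleProb f (w ++ [.idle]) k) := by
          rw [Finset.sum_range_succ', add_comm, ← ENNReal.ofReal_mul hq,
            one_add_ofReal (mul_nonneg hq hsum), Finset.mul_sum]
          rfl
      _ ≤ 1 + ENNReal.ofReal (1 - f.prob w) *
            remainingTime f ![x ++ [.idle], w ++ [.idle]] := by
          gcongr
          exact ih (List.mem_append_left _ hx) (by simpa using hw)
      _ ≤ remainingTime f ![x, w] := one_add_le_remainingTime f hx hw

theorem ofReal_roundTime_add_le_remainingTime (f : Policy) {m : ℝ} (hm : 0 ≤ m)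
    (hle : ∀ w, .success ∉ w → ENNReal.ofReal m ≤ remainingTime f ![w, w]) {w : List Response}
    (hw : .success ∉ w) (n : ℕ) :
    ENNReal.ofReal (roundTime (idleProb f w) n + m * collisionProb (idleProb f w) n)
      ≤ remainingTime f ![w, w] := by
  induction n generalizing w with
  | zero =>
    simp only [roundTime, collisionProb, Finset.range_zero, Finset.sum_empty, mul_zero, add_zero,
      ENNReal.ofReal_zero, zero_le]
  | succ n ih =>
    have hidle : .success ∉ w ++ [Response.idle] := by simpa using hw
    have hcoll : .success ∉ w ++ [Response.collision] := by simpa using hw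
    set b := idleProb f (w ++ [.idle])
    have hb : ∀ k, b k ∈ Set.Icc 0 1 := idleProb_mem_Icc f _
    have hsum : 0 ≤ ∑ k ∈ Finset.range n, b k := Finset.sum_nonneg fun k _ => (hb k).1
    have hround : 0 ≤ roundTime b n + m * collisionProb b n :=
      add_nonneg (roundTime_nonneg hb n) (mul_nonneg hm (collisionProb_nonneg b n))
    have hafter_collision := hle _ hcoll
    have hafter_success := ofReal_sum_idleProb_le_remainingTime f
      (x := w ++ [.success]) (by simp) hidle n
    have hafter_idle := ih hidle
    calc ENNReal.ofReal (roundTime (idleProb f w) (n + 1)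
          + m * collisionProb (idleProb f w) (n + 1))
        = 1 + (ENNReal.ofReal (f.prob w) * (ENNReal.ofReal (f.prob w) * ENNReal.ofReal m
              + ENNReal.ofReal (1 - f.prob w) * ENNReal.ofReal (∑ k ∈ Finset.range n, b k))
            + ENNReal.ofReal (1 - f.prob w) *
              (ENNReal.ofReal (f.prob w) * ENNReal.ofReal (∑ k ∈ Finset.range n, b k)
                + ENNReal.ofReal (1 - f.prob w) *
                  ENNReal.ofReal (roundTime b n + m * collisionProb b n))) := by
          rw [ofReal_two_device_step (f.prob w).2 hm hsum hround, roundTime_idleProb_succ,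
            collisionProb_idleProb_succ]
          congr 1
          ring
      _ ≤ remainingTime f ![w, w] := by
          rw [remainingTime_diag f hw]
          gcongr

/- The infimum `M` over all success-free histories is bounded below in terms of itself, because
after a collision both devices again share such a history; below `1 / γ` this bound exceeds `M`. -/
theorem ofReal_one_div_le_remainingTime (f : Policy) {γ : ℝ} (hγ : 0 < γ) {n : ℕ}
    (hround : ∀ w, 1 ≤ γ * roundTime (idleProb f w) (n + 1)
      + collisionProb (idleProb f w) (n + 1)) {w : List Response} (hw : .success ∉ w) :
    ENNReal.ofReal (1 / γ) ≤ remainingTime f ![w, w] := by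
  by_contra! hlt
  set M := ⨅ (w : List Response) (_ : .success ∉ w), remainingTime f ![w, w]
  have hMw : M < ENNReal.ofReal (1 / γ) := (iInf₂_le w hw).trans_lt hlt
  obtain ⟨m, hm0, hMm⟩ : ∃ m : ℝ, 0 ≤ m ∧ M = ENNReal.ofReal m :=
    ⟨M.toReal, ENNReal.toReal_nonneg, (ENNReal.ofReal_toReal hMw.ne_top).symm⟩
  have hmγ : 0 < 1 - m * γ := by
    rw [hMm, ENNReal.ofReal_lt_ofReal_iff (one_div_pos.2 hγ), lt_div_iff₀ hγ] at hMw
    linarith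
  have hle : ∀ w, .success ∉ w → ENNReal.ofReal m ≤ remainingTime f ![w, w] := fun w hw =>
    hMm ▸ iInf₂_le w hw
  have himproved : ENNReal.ofReal (m + (1 - m * γ)) ≤ M := le_iInf₂ fun w hw => by
    refine le_trans (ENNReal.ofReal_le_ofReal ?_)
      (ofReal_roundTime_add_le_remainingTime f hm0 hle hw (n + 1))
    have htime := one_le_roundTime_succ (idleProb_mem_Icc f w) (by rw [idleProb]) n
    calc m + (1 - m * γ)
        = m * 1 + (1 - m * γ) * 1 := by ring
      _ ≤ m * (γ * roundTime (idleProb f w) (n + 1) + collisionProb (idleProb f w) (n + 1))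
            + (1 - m * γ) * roundTime (idleProb f w) (n + 1) := by
          gcongr
          exact hround w
      _ = roundTime (idleProb f w) (n + 1) + m * collisionProb (idleProb f w) (n + 1) := by ring
  rw [hMm, ENNReal.ofReal_le_ofReal_iff hm0] at himproved
  linarith

theorem one_le_mul_roundTime_add_collisionProb {γ : ℝ} (hγ : γ ∈ Set.Icc (1 / 4) (1 / 3))
    (hcubic : 0 ≤ 3 * γ ^ 3 - 12 * γ ^ 2 + 10 * γ - 2) {b : ℕ → ℝ} (hb0 : b 0 = 1)
    (hb3 : b 3 ∈ Set.Icc 0 1) : 1 ≤ γ * roundTime b 4 + collisionProb b 4 := by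
  obtain ⟨hγl, hγu⟩ := hγ
  set excess := γ * (1 + (2 * b 1 - b 1 ^ 2) + (2 * b 2 - b 2 ^ 2) + (2 * b 3 - b 3 ^ 2))
    + ((1 - b 1) ^ 2 + (b 1 - b 2) ^ 2 + (b 2 - b 3) ^ 2) - 1 with hexcess
  have hscale : 0 < (1 - γ) * (3 - γ) * (2 - γ) := by
    have := mul_pos (show 0 < 1 - γ by linarith) (show 0 < 3 - γ by linarith)
    exact mul_pos this (by linarith)
  have hthird : 0 ≤ γ ^ 3 - 5 * γ ^ 2 + 6 * γ - 1 := by nlinarith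
  -- Complete the square in `b 1`, then in `b 2`; the constant that remains is the cubic in `γ`.
  -- Equality forces `b 3 = 0` and hence the tails `1 - α`, `(1 - α) * (1 - β)` of the protocol.
  have hsquares : (1 - γ) * (3 - γ) * (2 - γ) * excess =
      (1 - γ) * (3 - γ) * ((2 - γ) * b 1 - (1 - γ + b 2)) ^ 2
      + ((1 - γ) * (3 - γ) * b 2 + (3 * γ - γ ^ 2 - 1) - (2 - γ) * b 3) ^ 2
      + (2 - γ) * (3 * γ ^ 3 - 12 * γ ^ 2 + 10 * γ - 2)
      + (2 - γ) * ((γ ^ 3 - 5 * γ ^ 2 + 6 * γ - 1) * (b 3 * (2 - b 3))) := by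
    rw [hexcess]; ring
  have hnonneg : 0 ≤ excess := by
    refine nonneg_of_mul_nonneg_right ?_ hscale
    rw [hsquares]
    have h1 : 0 ≤ 1 - γ := by linarith
    have h2 : 0 ≤ 2 - γ := by linarith
    have h3 : 0 ≤ 3 - γ := by linarith
    have h4 : 0 ≤ b 3 * (2 - b 3) := mul_nonneg hb3.1 (by linarith [hb3.2])
    positivity
  simp only [roundTime, collisionProb, Finset.sum_range_succ, Finset.sum_range_zero, zero_add, hb0]
  nlinarith [sq_nonneg (b 3 - b 4)]

theorem ofReal_one_div_le_expectedCost {γ : ℝ} (hγ : γ ∈ Set.Icc (1 / 4) (1 / 3))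
    (hcubic : 0 ≤ 3 * γ ^ 3 - 12 * γ ^ 2 + 10 * γ - 2) (f : Policy) :
    ENNReal.ofReal (1 / γ) ≤ expectedCost maxObjective f := by
  rw [expectedCost_maxObjective]
  exact ofReal_one_div_le_remainingTime f (by linarith [hγ.1])
    (fun w => one_le_mul_roundTime_add_collisionProb hγ hcubic (by rw [idleProb])
      (idleProb_mem_Icc f w 3)) List.not_mem_nil

end LowerBound

section Protocol

theorem Step.run_append (s : Step) (w : List Response) (r : Response) :
    Step.run s (w ++ [r]) = Step.next (Step.run s w) r := by
  simp only [Step.run, List.foldl_append, List.foldl_cons, List.foldl_nil]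

theorem Step.success_mem_of_run_eq_halted {w : List Response}
    (h : Step.run .step1 w = .halted) : .success ∈ w := by
  induction w using List.reverseRecOn with
  | nil => cases h
  | append_singleton w r ih =>
    rw [Step.run_append] at h
    rw [List.mem_append, List.mem_singleton]
    cases hs : Step.run .step1 w <;> cases r <;> simp_all [Step.next]

/-- The expected remaining time of the three-step protocol in terms of the steps of the two
devices, when it is `J` for two devices in Step 1. The value `⊤` marks the pairs of steps that are
never reached; the unsimplified terms match the one-slot recursion `ofReal_two_device_step`. -/
noncomputable def stepCost (β J : ℝ) : Step → Step → ℝ≥0∞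
  | .step1, .step1 => ENNReal.ofReal J
  | .step2, .step2 =>
    ENNReal.ofReal (1 + β ^ 2 * J + 2 * β * (1 - β) * 1 + (1 - β) ^ 2 * (1 + J))
  | .step3, .step3 => ENNReal.ofReal (1 + J)
  | .halted, .step2 | .step2, .halted => ENNReal.ofReal (1 + (1 - β))
  | .halted, .step3 | .step3, .halted => 1
  | .halted, .halted => 0
  | _, _ => ⊤

theorem slotCost_add_transition_stepCost_le {α β : I} {J : ℝ} (hJ : 0 ≤ J)
    (hstep1 : 1 + (α : ℝ) ^ 2 * J + 2 * α * (1 - α) * (1 + (1 - β)) + (1 - (α : ℝ)) ^ 2 *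
      (1 + (β : ℝ) ^ 2 * J + 2 * β * (1 - β) * 1 + (1 - (β : ℝ)) ^ 2 * (1 + J)) ≤ J)
    (x y : List Response) :
    slotCost ![x, y] + transition (threeStepProtocol α β)
        (fun h => stepCost β J (Step.run .step1 (h 0)) (Step.run .step1 (h 1))) ![x, y]
      ≤ stepCost β J (Step.run .step1 x) (Step.run .step1 y) := by
  have hβ0 : (0 : ℝ) ≤ β := β.2.1
  have hβ1 : (0 : ℝ) ≤ 1 - β := sub_nonneg.2 β.2.2
  have hcost : slotCost ![x, y] ≤ 1 := slotCost_le_one _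
  have hpair1 := ofReal_two_device_step (p := α) (A := J) (B := 1 + (1 - β))
    (C := 1 + (β : ℝ) ^ 2 * J + 2 * β * (1 - β) * 1 + (1 - (β : ℝ)) ^ 2 * (1 + J)) α.2 hJ
    (by positivity) (by positivity)
  have hpair2 := ofReal_two_device_step (p := β) (A := J) (B := 1) (C := 1 + J) β.2 hJ
    zero_le_one (by positivity)
  rw [ENNReal.ofReal_one] at hpair2
  have hpair3 := one_add_ofReal hJ
  have hsolo2 := one_add_ofReal hβ1
  rw [transition_pair]
  simp only [threeStepProtocol, Step.run_append, Matrix.cons_val_zero, Matrix.cons_val_one,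
    Matrix.cons_val_fin_one]
  cases hx : Step.run .step1 x <;> cases hy : Step.run .step1 y <;>
    simp only [Step.next, Step.transmitProb, stepCost, le_top]
  · exact (add_le_add_left hcost _).trans (hpair1.trans_le (ENNReal.ofReal_le_ofReal hstep1))
  · exact (add_le_add_left hcost _).trans hpair2.le
  · simpa using (add_le_add_left hcost _).trans hsolo2.le
  · simpa using (add_le_add_left hcost _).trans hpair3.le
  · simpa using hcost
  · simpa using (add_le_add_left hcost _).trans hsolo2.le
  · simpa using hcost
  · have hx := Step.success_mem_of_run_eq_halted hx
    have hy := Step.success_mem_of_run_eq_halted hy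
    simp [slotCost, Fin.forall_fin_two, hx, hy]

theorem roundTime_threeStepProtocol (α β : I) :
    roundTime (idleProb (threeStepProtocol α β) []) 3 =
      1 + (2 * (1 - α) - (1 - (α : ℝ)) ^ 2)
        + (2 * ((1 - α) * (1 - β)) - ((1 - (α : ℝ)) * (1 - β)) ^ 2) := by
  simp only [roundTime, Finset.sum_range_succ, Finset.sum_range_zero, idleProb, threeStepProtocol,
    Step.run, List.nil_append, List.foldl_nil, List.foldl_cons, Step.next, Step.transmitProb]
  ring

theorem collisionProb_threeStepProtocol (α β : I) :
    collisionProb (idleProb (threeStepProtocol α β) []) 3 =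
      (α : ℝ) ^ 2 + ((1 - α) - (1 - α) * (1 - β)) ^ 2 + ((1 - (α : ℝ)) * (1 - β)) ^ 2 := by
  norm_num [collisionProb, Finset.sum_range_succ, idleProb, threeStepProtocol, Step.run, Step.next,
    Step.transmitProb]

theorem expectedCost_threeStepProtocol_le {α β : I} {J : ℝ} (hJ : 0 ≤ J)
    (hround : roundTime (idleProb (threeStepProtocol α β) []) 3
      + J * collisionProb (idleProb (threeStepProtocol α β) []) 3 ≤ J) :
    expectedCost maxObjective (threeStepProtocol α β) ≤ ENNReal.ofReal J := by
  have hstep1 : 1 + (α : ℝ) ^ 2 * J + 2 * α * (1 - α) * (1 + (1 - β)) + (1 - (α : ℝ)) ^ 2 *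
      (1 + (β : ℝ) ^ 2 * J + 2 * β * (1 - β) * 1 + (1 - (β : ℝ)) ^ 2 * (1 + J)) ≤ J := by
    rw [roundTime_threeStepProtocol, collisionProb_threeStepProtocol] at hround
    linarith
  rw [expectedCost_maxObjective]
  refine remainingTime_le_of_superharmonic (threeStepProtocol α β)
    (V := fun h => stepCost β J (Step.run .step1 (h 0)) (Step.run .step1 (h 1))) (fun h => ?_)
    ![[], []]
  have hpair : h = ![h 0, h 1] := List.ofFn_inj.1 rfl
  rw [hpair]
  exact slotCost_add_transition_stepCost_le hJ hstep1 (h 0) (h 1)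

theorem expectedCost_threeStepProtocol_le_one_div {α β : I} {γ : ℝ} (hγ : 0 < γ)
    (hγ0 : 3 * γ ^ 3 - 12 * γ ^ 2 + 10 * γ - 2 = 0) (hα : (α : ℝ) = -1 + 6 * γ - 3 * γ ^ 2)
    (hβ : (β : ℝ) = 2 - 9 / 2 * γ + 3 / 2 * γ ^ 2) :
    expectedCost maxObjective (threeStepProtocol α β) ≤ ENNReal.ofReal (1 / γ) := by
  refine expectedCost_threeStepProtocol_le (one_div_pos.2 hγ).le (le_of_eq ?_)
  have htail1 : 1 - (α : ℝ) = 2 - 6 * γ + 3 * γ ^ 2 := by rw [hα]; ring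
  have htail2 : (1 - (α : ℝ)) * (1 - β) = 1 - 3 * γ := by
    rw [hα, hβ]
    linear_combination (3 / 2 - 3 / 2 * γ) * hγ0
  rw [roundTime_threeStepProtocol, collisionProb_threeStepProtocol, htail2, htail1, hα]
  field_simp
  linear_combination (-1 + 6 * γ - 3 * γ ^ 2) * hγ0

end Protocol

section Cubics

theorem existsUnique_root_of_injOn {p : ℝ → ℝ} {a b : ℝ} (hab : a ≤ b)
    (hp : ContinuousOn p (Set.Icc a b)) (hinj : Set.InjOn p (Set.Icc a b))
    (h0 : 0 ∈ Set.uIcc (p a) (p b)) : ∃! x, x ∈ Set.Icc a b ∧ p x = 0 := by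
  rw [← Set.uIcc_of_le hab] at hp hinj ⊢
  obtain ⟨x, hx, hpx⟩ := intermediate_value_uIcc hp h0
  exact ⟨x, ⟨hx, hpx⟩, fun y ⟨hy, hpy⟩ => hinj hy hx (hpy.trans hpx.symm)⟩

theorem strictAntiOn_alphaCubic :
    StrictAntiOn (fun x : ℝ => x ^ 3 + 7 * x ^ 2 - 21 * x + 9) (Set.Icc 0 1) := by
  intro x hx y hy hxy
  have hfactor : x ^ 2 + x * y + y ^ 2 + 7 * (x + y) - 21 < 0 := by
    nlinarith [hx.1, hx.2, hy.1, hy.2]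
  linarith [mul_neg_of_pos_of_neg (sub_pos.2 hxy) hfactor]

theorem strictAntiOn_betaCubic :
    StrictAntiOn (fun x : ℝ => 4 * x ^ 3 - 8 * x ^ 2 + 3) (Set.Icc 0 1) := by
  intro x hx y hy hxy
  have hfactor : 4 * (x ^ 2 + x * y + y ^ 2) - 8 * (x + y) < 0 := by
    nlinarith [hx.1, hx.2, hy.1, hy.2]
  linarith [mul_neg_of_pos_of_neg (sub_pos.2 hxy) hfactor]

theorem strictMonoOn_gammaCubic :
    StrictMonoOn (fun x : ℝ => 3 * x ^ 3 - 12 * x ^ 2 + 10 * x - 2) (Set.Icc (1 / 4) (1 / 3)) := by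
  intro x hx y hy hxy
  have hfactor : 0 < 3 * (x ^ 2 + x * y + y ^ 2) - 12 * (x + y) + 10 := by
    nlinarith [hx.1, hx.2, hy.1, hy.2]
  linarith [mul_pos (sub_pos.2 hxy) hfactor]

theorem existsUnique_alpha :
    ∃! x : ℝ, x ∈ Set.Icc (0 : ℝ) 1 ∧ x ^ 3 + 7 * x ^ 2 - 21 * x + 9 = 0 :=
  existsUnique_root_of_injOn zero_le_one (by fun_prop) strictAntiOn_alphaCubic.injOn
    (Set.mem_uIcc.2 (by norm_num))

theorem existsUnique_beta :
    ∃! x : ℝ, x ∈ Set.Icc (0 : ℝ) 1 ∧ 4 * x ^ 3 - 8 * x ^ 2 + 3 = 0 :=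
  existsUnique_root_of_injOn zero_le_one (by fun_prop) strictAntiOn_betaCubic.injOn
    (Set.mem_uIcc.2 (by norm_num))

theorem existsUnique_gamma :
    ∃! x : ℝ, x ∈ Set.Icc (1 / 4 : ℝ) (1 / 3) ∧ 3 * x ^ 3 - 12 * x ^ 2 + 10 * x - 2 = 0 :=
  existsUnique_root_of_injOn (by norm_num) (by fun_prop) strictMonoOn_gammaCubic.injOn
    (Set.mem_uIcc.2 (by norm_num))

variable {α β γ : ℝ}

/- The minimizing tails in `one_le_mul_roundTime_add_collisionProb` are `b 1 = 1 - α` and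
`b 2 = (1 - α) * (1 - β)`; solving for `α` and `β` modulo the cubic of `γ` gives the quadratics. -/
theorem alpha_eq (hα : α ∈ Set.Icc 0 1) (hα0 : α ^ 3 + 7 * α ^ 2 - 21 * α + 9 = 0)
    (hγ : γ ∈ Set.Icc (1 / 4) (1 / 3)) (hγ0 : 3 * γ ^ 3 - 12 * γ ^ 2 + 10 * γ - 2 = 0) :
    α = -1 + 6 * γ - 3 * γ ^ 2 := by
  refine existsUnique_alpha.unique ⟨hα, hα0⟩ ⟨⟨?_, ?_⟩, ?_⟩
  · nlinarith [hγ.1, hγ.2]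
  · nlinarith [hγ.1, hγ.2]
  · linear_combination (-18 + 6 * γ + 18 * γ ^ 2 - 9 * γ ^ 3) * hγ0

theorem beta_eq (hβ : β ∈ Set.Icc 0 1) (hβ0 : 4 * β ^ 3 - 8 * β ^ 2 + 3 = 0)
    (hγ : γ ∈ Set.Icc (1 / 4) (1 / 3)) (hγ0 : 3 * γ ^ 3 - 12 * γ ^ 2 + 10 * γ - 2 = 0) :
    β = 2 - 9 / 2 * γ + 3 / 2 * γ ^ 2 := by
  refine existsUnique_beta.unique ⟨hβ, hβ0⟩ ⟨⟨?_, ?_⟩, ?_⟩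
  · nlinarith [hγ.1, hγ.2]
  · nlinarith [hγ.1, hγ.2]
  · linear_combination (-3 / 2 + 57 / 2 * γ - 45 / 2 * γ ^ 2 + 9 / 2 * γ ^ 3) * hγ0

theorem gamma_mem_Ioo (hγ : γ ∈ Set.Icc (1 / 4) (1 / 3))
    (hγ0 : 3 * γ ^ 3 - 12 * γ ^ 2 + 10 * γ - 2 = 0) :
    γ ∈ Set.Ioo (0.2997231 : ℝ) 0.2997232 := by
  constructor
  · exact (strictMonoOn_gammaCubic.lt_iff_lt (by norm_num) hγ).1 (hγ0.symm ▸ by norm_num)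
  · exact (strictMonoOn_gammaCubic.lt_iff_lt hγ (by norm_num)).1 (hγ0 ▸ by norm_num)

theorem abs_one_div_sub_lt (hγ : γ ∈ Set.Ioo (0.2997231 : ℝ) 0.2997232) :
    |1 / γ - 3.33641| < 0.000005 := by
  have hγpos : 0 < γ := by linarith [hγ.1]
  have hlower : 3.336405 < 1 / γ := (lt_div_iff₀ hγpos).2 (by linarith [hγ.2])
  have hupper : 1 / γ < 3.336415 := (div_lt_iff₀ hγpos).2 (by linarith [hγ.1])
  rw [abs_lt]
  constructor <;> linarith

end Cubics

end ContentionResolution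

open ContentionResolution in
theorem mainTheorem2 :
    (∃! x : ℝ, x ∈ Set.Icc (0 : ℝ) 1 ∧ x ^ 3 + 7 * x ^ 2 - 21 * x + 9 = 0) ∧
    (∃! x : ℝ, x ∈ Set.Icc (0 : ℝ) 1 ∧ 4 * x ^ 3 - 8 * x ^ 2 + 3 = 0) ∧
    (∃! x : ℝ, x ∈ Set.Icc (1 / 4 : ℝ) (1 / 3) ∧ 3 * x ^ 3 - 12 * x ^ 2 + 10 * x - 2 = 0) ∧
    ∀ (α β : unitInterval) (γ : ℝ),
      (α : ℝ) ^ 3 + 7 * (α : ℝ) ^ 2 - 21 * (α : ℝ) + 9 = 0 →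
      4 * (β : ℝ) ^ 3 - 8 * (β : ℝ) ^ 2 + 3 = 0 →
      γ ∈ Set.Icc (1 / 4 : ℝ) (1 / 3) →
      3 * γ ^ 3 - 12 * γ ^ 2 + 10 * γ - 2 = 0 →
      IsOptimal maxObjective (threeStepProtocol α β) ∧
      expectedCost maxObjective (threeStepProtocol α β) = ENNReal.ofReal (1 / γ) ∧
      |(α : ℝ) - 0.528837| < 0.0000005 ∧
      |(β : ℝ) - 0.785997| < 0.0000005 ∧
      |γ - 0.299723| < 0.0000005 ∧
      |1 / γ - 3.33641| < 0.000005 := by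
  refine ⟨existsUnique_alpha, existsUnique_beta, existsUnique_gamma,
    fun α β γ hα0 hβ0 hγ hγ0 => ?_⟩
  have hα := alpha_eq α.2 hα0 hγ hγ0
  have hβ := beta_eq β.2 hβ0 hγ hγ0
  have hlower := ofReal_one_div_le_expectedCost hγ hγ0.ge
  have hupper := expectedCost_threeStepProtocol_le_one_div (by linarith [hγ.1]) hγ0 hα hβ
  obtain ⟨hγl, hγu⟩ := gamma_mem_Ioo hγ hγ0
  refine ⟨fun g => hupper.trans (hlower g), hupper.antisymm (hlower _), ?_, ?_, ?_,
    abs_one_div_sub_lt ⟨hγl, hγu⟩⟩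
  · rw [hα, abs_lt]; constructor <;> nlinarith
  · rw [hβ, abs_lt]; constructor <;> nlinarith
  · rw [abs_lt]; constructor <;> linarith
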